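/- Let $1\le p\le\infty$. A metric measure space is a triple $(X,d,\mu)$ where $(X,d)$ is a proper metric space and $\mu$ is a Borel (regular) measure on $X$ such that every ball $B(x,r)$, $r>0$, has positive and finite measure. It is infinitesimally doubling if $$\limsup_{r\to 0}\frac{\mu(B(x,2r))}{\mu(B(x,r))}<\infty\quad\text{for }\mu\text{-almost every }x\in X.$$ Curves are continuous maps $\gamma\colon[0,1]\to X$, $\ell(\gamma)$ is the length of $\gamma$, and for a Borel function $g\colon X\to[0,\infty]$ the line integral $\int_\gamma g$ is $\int_0^{\ell(\gamma)}g(\gamma_s(t))\,dt$, with $\gamma_s$ the arc length parametrization, if $\ell(\gamma)<\infty$, and $\infty$ otherwise. The $p$-modulus of a family $\Gamma$ of curves is $$\operatorname{Mod}_p(\Gamma)=\inf_g\int_X g^p\,d\mu\quad(p<\infty),\qquad \operatorname{Mod}_\infty(\Gamma)=\inf_g\ \operatorname{ess\,sup}_{X}\, g,$$ the infimum being over all Borel $g\colon X\to[0,\infty]$ with $\int_\gamma g\ge 1$ for every $\gamma\in\Gamma$. For $E,F\subset X$ and $C\ge 1$ let $\Gamma(E,F;C)$ be the family of curves $\gamma$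 with $\gamma(0)\in E$, $\gamma(1)\in F$ and $\ell(\gamma)\le C\,d(\gamma(0),\gamma(1))$. The space $(X,d,\mu)$ is $p$-thick quasiconvex with constant $C\geq 1$ if $\operatorname{Mod}_p\Gamma(E,F;C)>0$ for all $\mu$-measurable $E,F\subset X$ of positive measure, and $p$-thick geodesic if it is $p$-thick quasiconvex with constant $C$ for every $C>1$. **Theorem.** Let $(X,d,\mu)$ be an infinitesimally doubling metric measure space that is $p$-thick quasiconvex with constant $C\ge 1$. Then there is a metric $d_p$ on $X$ with $d\le d_p\le C\,d$ such that $(X,d_p,\mu)$ is a metric measure space that is $p$-thick geodesic. Moreover $d_p$ is minimal in the sense that $d_p\le\rho$ for every metric $\rho\ge d$ on $X$ for which $(X,\rho,\mu)$ is a $p$-thick geodesic metric measure space. -/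

import Mathlib

open Set Filter Topology MeasureTheory
open scoped ENNReal unitInterval

/- The metric is always an explicit argument, because several metrics on one set `X` are compared.
Curves are functions on `[0, 1]`, and their continuity is a separate requirement. -/

/-- `(X, d, μ)` is a metric measure space: `(X, d)` is proper, `μ` is a Borel measure (the
measurable sets of `X` are the Borel sets of `d`), and all balls have positive finite measure. -/
structure IsMetricMeasureSpace {X : Type*} [MeasurableSpace X] (d : MetricSpace X)
    (μ : Measure X) : Prop where
  proper : ProperSpace X
  borel : BorelSpace X
  ball_pos : ∀ (x : X) (r : ℝ), 0 < r → 0 < μ (Metric.ball x r)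
  ball_lt_top : ∀ (x : X) (r : ℝ), μ (Metric.ball x r) < ∞

/-- The infinitesimal doubling condition: `limsup_{r → 0} μ(B(x,2r)) / μ(B(x,r)) < ∞` for
`μ`-almost every `x`. -/
def InfinitesimallyDoubling {X : Type*} [MeasurableSpace X] (d : MetricSpace X)
    (μ : Measure X) : Prop :=
  ∀ᵐ x ∂μ, limsup (fun r : ℝ => μ (Metric.ball x (2 * r)) / μ (Metric.ball x r)) (𝓝[>] 0) < ∞

/-- The length of a curve: the supremum of `∑ d(γ(tᵢ), γ(tᵢ₊₁))` over partitions. -/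
noncomputable def curveLength {X : Type*} (d : MetricSpace X) (γ : I → X) : ℝ≥0∞ :=
  eVariationOn γ univ

open Classical in
/-- The line integral of `g` over `γ`: the integral over `[0, ℓ(γ)]` of `g` along the arc length
parametrization of `γ` if `γ` is rectifiable, and `∞` otherwise. -/
noncomputable def lineIntegral {X : Type*} (d : MetricSpace X) (g : X → ℝ≥0∞) (γ : I → X) :
    ℝ≥0∞ :=
  if curveLength d γ < ∞ then
    ∫⁻ t in Icc (0 : ℝ) (curveLength d γ).toReal, g (naturalParameterization γ univ 0 t)
  else ∞

/-- `g : X → [0, ∞]` is Borel and has line integral at least `1` over every curve of `Γ`. -/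
def IsAdmissible {X : Type*} [MeasurableSpace X] (d : MetricSpace X) (Γ : Set (I → X))
    (g : X → ℝ≥0∞) : Prop :=
  Measurable g ∧ ∀ γ ∈ Γ, 1 ≤ lineIntegral d g γ

open Classical in
/-- The `p`-modulus of a family of curves: the infimum over admissible `g` of `∫ g ^ p dμ` if
`p < ∞`, and of the essential supremum of `g` if `p = ∞`. -/
noncomputable def modulus {X : Type*} [MeasurableSpace X] (d : MetricSpace X) (μ : Measure X)
    (p : ℝ≥0∞) (Γ : Set (I → X)) : ℝ≥0∞ :=
  if p = ∞ then ⨅ (g : X → ℝ≥0∞) (_ : IsAdmissible d Γ g), essSup g μ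
  else ⨅ (g : X → ℝ≥0∞) (_ : IsAdmissible d Γ g), ∫⁻ x, g x ^ p.toReal ∂μ

/-- `Γ(E, F; C)`: the curves `γ` from `E` to `F` with `ℓ(γ) ≤ C d(γ(0), γ(1))`. -/
def quasiconvexCurves {X : Type*} (d : MetricSpace X) (E F : Set X) (C : ℝ) : Set (I → X) :=
  {γ | Continuous γ ∧ γ 0 ∈ E ∧ γ 1 ∈ F ∧
    curveLength d γ ≤ ENNReal.ofReal (C * dist (γ 0) (γ 1))}

/-- `(X, d, μ)` is `p`-thick quasiconvex with constant `C`. -/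
def ThickQuasiconvex {X : Type*} [MeasurableSpace X] (d : MetricSpace X) (μ : Measure X)
    (p : ℝ≥0∞) (C : ℝ) : Prop :=
  ∀ E F : Set X, NullMeasurableSet E μ → NullMeasurableSet F μ → 0 < μ E → 0 < μ F →
    0 < modulus d μ p (quasiconvexCurves d E F C)

/-- `(X, d, μ)` is `p`-thick geodesic. -/
def ThickGeodesic {X : Type*} [MeasurableSpace X] (d : MetricSpace X) (μ : Measure X)
    (p : ℝ≥0∞) : Prop :=
  ∀ C : ℝ, 1 < C → ThickQuasiconvex d μ p C

/-! Take `dp x y` to be the supremum of `|f x - f y|` over the continuous `f` that have `1` as a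
`p`-weak upper gradient with respect to `d`. Distance functions are such `f`, so `d ≤ dp`. The bound
`dp ≤ C d` says that every such `f` is `C`-Lipschitz: thick quasiconvexity gives good curves between
arbitrarily small neighbourhoods of two points, and continuity passes to the limit
(`HasUnitUpperGradient.abs_sub_le`). Minimality is the same argument for a thick geodesic `ρ ≥ d`,
with the constant tending to `1`.

For thick geodesicity, fix a weight `G`, that is, a Borel function of finite cost. The families of
modulus zero are those on which one weight has infinite integral (`modulus_eq_zero_iff`), so a curve
with finite `G`-integral must be found. The distance from `E` along such curves is measurable
because its sublevel sets are analytic, and it has upper gradient `1`. By the Sobolev-to-Lipschitz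
property (`HasUnitUpperGradient.exists_continuous_ae_eq`) it agrees almost everywhere with an
admissible `f`, hence is bounded by `dp`. This produces curves whose `d`-length nearly equals `dp`.
Separability of `C(X, ℝ)` gives one weight for all `f` at once, so on its good curves `dp` is at
most the `d`-length, and those curves are no longer for `dp` than for `d`. -/

/-! ### Arc length and Lipschitz parametrizations. -/

theorem BoundedVariationOn.continuous_variationOnFromTo {α E : Type*} [LinearOrder α]
    [TopologicalSpace α] [OrderTopology α] [PseudoMetricSpace E] {f : α → E}
    (hf : BoundedVariationOn f univ) (hc : Continuous f) (a : α) :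
    Continuous (variationOnFromTo f univ a) := by
  refine continuous_iff_continuousAt.2 fun b => ?_
  rw [continuousAt_iff_continuous_left'_right']
  have hl := hf.locallyBoundedVariationOn
  constructor
  · have := variationOnFromTo.tendsto_left (mem_univ a) (mem_univ b) hl
      (hc.continuousWithinAt.tendsto (s := univ ∩ Iio b))
    simpa [ContinuousWithinAt] using this
  · have := variationOnFromTo.tendsto_right (mem_univ a) (mem_univ b) hl
      (hc.continuousWithinAt.tendsto (s := univ ∩ Ioi b))
    simpa [ContinuousWithinAt] using this

theorem LipschitzOnWith.comp_projIcc {E : Type*} [PseudoEMetricSpace E] {f : ℝ → E} {K : NNReal}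
    {a b : ℝ} (hf : LipschitzOnWith K f (Icc a b)) (hab : a ≤ b) :
    LipschitzWith K fun t => f (projIcc a b hab t) := by
  have := (lipschitzOnWith_iff_restrict.1 hf).comp (LipschitzWith.projIcc hab)
  rwa [mul_one] at this

section
variable {X : Type*} (d : MetricSpace X)

theorem variationOnFromTo_zero_one (c : I → X) :
    variationOnFromTo c univ 0 1 = (curveLength d c).toReal := by
  rw [variationOnFromTo.eq_of_le _ _ zero_le_one, curveLength]
  congr 2
  ext t
  simp [unitInterval.le_one']

theorem image_variationOnFromTo {c : I → X} (hc : Continuous c) (hl : curveLength d c < ∞) :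
    variationOnFromTo c univ 0 '' univ = Icc 0 (curveLength d c).toReal := by
  have hb : BoundedVariationOn c univ := hl.ne
  have h0 : variationOnFromTo c univ 0 0 = 0 := variationOnFromTo.self _ _ _
  have h1 := variationOnFromTo_zero_one d c
  have hm := variationOnFromTo.monotoneOn hb.locallyBoundedVariationOn (mem_univ (0 : I))
  apply subset_antisymm
  · rintro _ ⟨t, -, rfl⟩
    exact ⟨h0 ▸ hm (mem_univ _) (mem_univ _) unitInterval.nonneg', h1 ▸ hm (mem_univ _) (mem_univ _)
      unitInterval.le_one'⟩
  · have := intermediate_value_Icc (zero_le_one (α := I))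
      (hb.continuous_variationOnFromTo hc 0).continuousOn
    rw [h0, h1] at this
    exact this.trans (image_mono (subset_univ _))

/-- A rectifiable curve of finite line integral has a `1`-Lipschitz parametrization. -/
theorem exists_lipschitz_parametrization {c : I → X} (hc : Continuous c)
    (hl : curveLength d c < ∞) {g : X → ℝ≥0∞} (hg : lineIntegral d g c < ∞) :
    ∃ γ : ℝ → X, LipschitzWith 1 γ ∧ γ 0 = c 0 ∧ γ (curveLength d c).toReal = c 1 ∧
      ∫⁻ t in Icc 0 (curveLength d c).toReal, g (γ t) < ∞ := by
  have hb : BoundedVariationOn c univ := hl.ne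
  have hlb := hb.locallyBoundedVariationOn
  set l := (curveLength d c).toReal with hldef
  have hl0 : 0 ≤ l := ENNReal.toReal_nonneg
  set η := naturalParameterization c univ 0 with hη
  have himg := image_variationOnFromTo d hc hl
  have hs : HasUnitSpeedOn η (Icc 0 l) := by
    rw [hldef, ← himg]
    exact has_unit_speed_naturalParameterization c hlb (mem_univ _)
  have hη' : ∀ t, η (variationOnFromTo c univ 0 t) = c t := fun t =>
    edist_eq_zero.1 (edist_naturalParameterization_eq_zero hlb (mem_univ _) (mem_univ t))
  have hlip : LipschitzOnWith 1 η (Icc 0 l) := by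
    intro s hs' t ht
    wlog hst : s ≤ t generalizing s t
    · rw [edist_comm, edist_comm s]
      exact this ht hs' (not_le.1 hst).le
    have := hs hs' ht
    calc edist (η s) (η t) ≤ eVariationOn η (Icc 0 l ∩ Icc s t) :=
          eVariationOn.edist_le _ ⟨hs', le_rfl, hst⟩ ⟨ht, hst, le_rfl⟩
      _ = _ := by
          rw [this, edist_comm, edist_dist, Real.dist_eq, abs_of_nonneg (sub_nonneg.2 hst)]
          simp
  -- Unit speed is known only on `[0, l]`; freezing the curve outside makes it globally Lipschitz.
  have hproj : ∀ t (ht : t ∈ Icc 0 l), η (projIcc 0 l hl0 t) = η t := fun t ht => by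
    rw [projIcc_of_mem hl0 ht]
  refine ⟨fun t => η (projIcc 0 l hl0 t), hlip.comp_projIcc hl0, ?_, ?_, ?_⟩
  · beta_reduce
    rw [hproj 0 (left_mem_Icc.2 hl0), ← hη' 0, variationOnFromTo.self]
  · have h1 : variationOnFromTo c univ 0 1 = l := variationOnFromTo_zero_one d c
    beta_reduce
    rw [hproj l (right_mem_Icc.2 hl0), ← hη' 1, h1]
  · rw [lineIntegral, if_pos hl] at hg
    refine lt_of_eq_of_lt (setLIntegral_congr_fun measurableSet_Icc fun t ht => ?_) hg
    beta_reduce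
    rw [hproj t ht]

/-- A `1`-Lipschitz map does not increase one-dimensional Hausdorff measure, so Lebesgue measure on
`A` is dominated by the pushforward of Lebesgue measure on `B`. No measurability of `g` is needed.
-/
theorem setLIntegral_le_of_subset_image {φ : ℝ → ℝ} (hφ : LipschitzWith 1 φ) {A B : Set ℝ}
    (h : A ⊆ φ '' B) (g : ℝ → ℝ≥0∞) : ∫⁻ t in A, g t ≤ ∫⁻ t in B, g (φ t) := by
  refine le_trans (lintegral_mono' ?_ le_rfl) (lintegral_map_le g φ)
  refine Measure.le_iff.2 fun S hS => ?_
  rw [Measure.map_apply hφ.continuous.measurable hS, Measure.restrict_apply hS,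
    Measure.restrict_apply (hφ.continuous.measurable hS)]
  calc volume (S ∩ A) ≤ volume (φ '' (φ ⁻¹' S ∩ B)) := by
        refine measure_mono ?_
        rintro t ⟨htS, ht⟩
        obtain ⟨s, hs, rfl⟩ := h ht
        exact ⟨s, ⟨htS, hs⟩, rfl⟩
    _ ≤ volume (φ ⁻¹' S ∩ B) := by
        have := hφ.hausdorffMeasure_image_le zero_le_one (φ ⁻¹' S ∩ B)
        simpa [hausdorffMeasure_real] using this

/-- Rescaling a `1`-Lipschitz curve on `[0, l]` to the unit interval. -/
theorem curveLength_le_and_lineIntegral_le {γ : ℝ → X} {l : ℝ} (hl0 : 0 ≤ l)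
    (hγ : LipschitzOnWith 1 γ (Icc 0 l)) (g : X → ℝ≥0∞) :
    let c : I → X := fun u => γ (l * u)
    Continuous c ∧ curveLength d c ≤ ENNReal.ofReal l ∧
      lineIntegral d g c ≤ ∫⁻ t in Icc 0 l, g (γ t) := by
  intro c
  have hmem : ∀ u : I, l * u ∈ Icc 0 l := fun u =>
    ⟨mul_nonneg hl0 u.2.1, mul_le_of_le_one_right hl0 u.2.2⟩
  have hvar : ∀ u v : I, u ≤ v →
      eVariationOn c (univ ∩ Icc u v) ≤ ENNReal.ofReal (l * v - l * u) := by
    intro u v huv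
    have h1 : c = γ ∘ fun w : I => l * (w : ℝ) := rfl
    have h2 := eVariationOn.comp_le_of_monotoneOn γ (s := Icc (l * (u : ℝ)) (l * v))
      (t := Icc u v) (fun w : I => l * (w : ℝ))
      (fun a _ b _ hab => mul_le_mul_of_nonneg_left hab hl0)
      (fun w hw => ⟨mul_le_mul_of_nonneg_left hw.1 hl0, mul_le_mul_of_nonneg_left hw.2 hl0⟩)
    have h3 := (hγ.mono (Icc_subset_Icc (hmem u).1 (hmem v).2)).comp_eVariationOn_le (g := id)
      (s := Icc (l * (u : ℝ)) (l * v)) (fun x hx => hx)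
    rw [eVariationOn_id_Icc, ENNReal.coe_one, one_mul] at h3
    rw [univ_inter, h1]
    exact h2.trans h3
  have hcont : Continuous c := by
    refine hγ.continuousOn.comp_continuous (by fun_prop) hmem
  have hlen : curveLength d c ≤ ENNReal.ofReal l := by
    have := hvar 0 1 zero_le_one
    have h01 : univ ∩ Icc (0 : I) 1 = univ := by
      ext t
      simp [unitInterval.le_one']
    simpa [h01, curveLength] using this
  have hlt : curveLength d c < ∞ := hlen.trans_lt ENNReal.ofReal_lt_top
  refine ⟨hcont, hlen, ?_⟩
  rw [lineIntegral, if_pos hlt]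
  have hb : BoundedVariationOn c univ := hlt.ne
  have hlb := hb.locallyBoundedVariationOn
  rcases hl0.eq_or_lt with rfl | hlpos
  · have : curveLength d c = 0 := by simpa using hlen
    simp [this]
  set V := variationOnFromTo c univ 0 with hV
  have hVdiff : ∀ u v : I, u ≤ v → V v - V u ≤ l * v - l * u := by
    intro u v huv
    rw [hV, variationOnFromTo.sub_right hlb (mem_univ _) (mem_univ _) (mem_univ _),
      variationOnFromTo.eq_of_le _ _ huv]
    exact ENNReal.toReal_le_of_le_ofReal
      (sub_nonneg.2 (mul_le_mul_of_nonneg_left huv hl0)) (hvar u v huv)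
  have hVm : Monotone V := fun u v huv =>
    variationOnFromTo.monotoneOn hlb (mem_univ _) (mem_univ _) (mem_univ _) huv
  -- `φ t` is the arc length covered by time `t`. It is `1`-Lipschitz, maps onto `[0, ℓ(c)]`, and
  -- the arc length parametrization at `φ t` is `γ t`.
  let π : ℝ → I := fun t => projIcc 0 1 zero_le_one (t / l)
  let φ : ℝ → ℝ := fun t => V (π t)
  have hπ : ∀ t, l * (π t : ℝ) = projIcc 0 l hl0 t := by
    intro t
    simp only [π, coe_projIcc]
    rw [mul_max_of_nonneg _ _ hl0, mul_min_of_nonneg _ _ hl0, mul_zero, mul_one,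
      mul_div_cancel₀ _ hlpos.ne']
  have hφ : LipschitzWith 1 φ := by
    refine LipschitzWith.of_le_add fun s t => ?_
    rcases le_total s t with hst | hts
    · have : π s ≤ π t := monotone_projIcc _ (by gcongr)
      have h2 := hVm this
      simp only [φ]
      linarith [dist_nonneg (x := s) (y := t)]
    · have : π t ≤ π s := monotone_projIcc _ (by gcongr)
      have h2 := hVdiff _ _ this
      rw [hπ, hπ] at h2
      have h3 := (LipschitzWith.projIcc hl0).dist_le_mul s t
      rw [Subtype.dist_eq, Real.dist_eq, NNReal.coe_one, one_mul] at h3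
      have := le_abs_self ((projIcc 0 l hl0 s : ℝ) - projIcc 0 l hl0 t)
      simp only [φ]
      linarith
  have hsurj : Icc 0 (curveLength d c).toReal ⊆ φ '' Icc 0 l := by
    rw [← image_variationOnFromTo d hcont hlt]
    rintro _ ⟨u, -, rfl⟩
    refine ⟨l * u, hmem u, ?_⟩
    have : π (l * u) = u := by
      simp only [π, mul_div_cancel_left₀ _ hlpos.ne']
      exact projIcc_val _ u
    simp only [φ, this, hV]
  refine (setLIntegral_le_of_subset_image hφ hsurj _).trans_eq ?_
  refine setLIntegral_congr_fun measurableSet_Icc fun t ht => ?_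
  have h1 : naturalParameterization c univ 0 (φ t) = c (π t) :=
    edist_eq_zero.1 (edist_naturalParameterization_eq_zero hlb (mem_univ _) (mem_univ _))
  simp only [h1, c, hπ, projIcc_of_mem hl0 ht]

end

/-! ### Measurability of analytic sets. -/

/-- Analytic subsets of a metrizable space are measurable with respect to the completion of any
finite Borel measure. -/
theorem MeasureTheory.AnalyticSet.nullMeasurableSet_of_isFiniteMeasure {α : Type*}
    [TopologicalSpace α] [TopologicalSpace.MetrizableSpace α] [MeasurableSpace α] [BorelSpace α]
    {μ : Measure α} [IsFiniteMeasure μ] {s : Set α} (hs : AnalyticSet s) :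
    NullMeasurableSet s μ := by
  rw [AnalyticSet] at hs
  rcases hs with rfl | ⟨f, hf, rfl⟩
  · exact MeasurableSet.empty.nullMeasurableSet
  -- points of the Baire space whose first `n` coordinates are bounded by those of `k`
  let B : (ℕ → ℕ) → ℕ → Set (ℕ → ℕ) := fun k n => {x | ∀ i < n, x i ≤ k i}
  -- Capacitability: bound the coordinates one at a time, losing `δ n` at stage `n`; the sequences
  -- satisfying all the bounds form a compact set.
  have key : ∀ ε : ℝ≥0∞, 0 < ε → ∃ K ⊆ range f, IsCompact K ∧ μ (range f) ≤ μ K + ε := by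
    intro ε hε
    obtain ⟨δ, hδ, hδε⟩ := ENNReal.exists_pos_sum_of_countable' hε.ne' ℕ
    have step : ∀ (n : ℕ) (k : ℕ → ℕ), ∃ m : ℕ,
        μ (f '' B k n) ≤ μ (f '' (B k n ∩ {x | x n ≤ m})) + δ n := by
      intro n k
      have hU : f '' B k n = ⋃ m : ℕ, f '' (B k n ∩ {x | x n ≤ m}) := by
        rw [← image_iUnion, ← inter_iUnion]
        congr 1
        refine (inter_eq_left.2 fun x _ => mem_iUnion.2 ⟨x n, le_refl (x n)⟩).symm
      have hmono : Monotone fun m : ℕ => f '' (B k n ∩ {x | x n ≤ m}) := fun a b hab =>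
        image_mono (inter_subset_inter_right _ fun x (hx : x n ≤ a) => hx.trans hab)
      by_contra! h
      have h1 : μ (f '' B k n) = ⨆ m : ℕ, μ (f '' (B k n ∩ {x | x n ≤ m})) := by
        conv_lhs => rw [hU]
        exact hmono.measure_iUnion
      have h2 : μ (f '' B k n) + δ n ≤ μ (f '' B k n) := by
        nth_rw 1 [h1]
        rw [ENNReal.iSup_add]
        exact iSup_le fun m => (h m).le
      exact absurd h2 (not_le.2 (ENNReal.lt_add_right (measure_ne_top _ _) (hδ n).ne'))
    choose m hm using step
    -- build `k` recursively
    let F : ℕ → (ℕ → ℕ) := fun n => Nat.rec (fun _ => 0)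
      (fun n k => Function.update k n (m n k)) n
    have hF : ∀ n, F (n + 1) = Function.update (F n) n (m n (F n)) := fun n => rfl
    let k : ℕ → ℕ := fun n => F (n + 1) n
    have hFk : ∀ n, ∀ i < n, F n i = k i := by
      intro n
      induction n with
      | zero => intro i hi; exact absurd hi (Nat.not_lt_zero i)
      | succ n ih =>
        intro i hi
        rcases Nat.lt_succ_iff_lt_or_eq.1 hi with h | rfl
        · rw [hF, Function.update_of_ne h.ne, ih i h]
        · rfl
    have hB : ∀ n, B (F n) n = B k n := fun n => by
      ext x
      exact forall₂_congr fun i hi => by rw [hFk n i hi]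
    have hBs : ∀ n, B k n ∩ {x | x n ≤ m n (F n)} = B k (n + 1) := fun n => by
      have hk : k n = m n (F n) := by simp [k, hF]
      ext x
      constructor
      · rintro ⟨h1, h2⟩ i hi
        rcases Nat.lt_succ_iff_lt_or_eq.1 hi with h | rfl
        · exact h1 i h
        · rw [hk]; exact h2
      · intro h
        exact ⟨fun i hi => h i (hi.trans (Nat.lt_succ_self n)), hk ▸ h n (Nat.lt_succ_self n)⟩
    have hsum : ∀ n, μ (range f) ≤ μ (f '' B k n) + ∑ i ∈ Finset.range n, δ i := by
      intro n
      induction n with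
      | zero => simp [B]
      | succ n ih =>
        refine ih.trans ?_
        have := hm n (F n)
        rw [hB, hBs] at this
        rw [Finset.sum_range_succ, add_comm _ (δ n), ← add_assoc]
        gcongr
    let C : Set (ℕ → ℕ) := Set.pi univ fun i => Iic (k i)
    have hC : IsCompact C := isCompact_univ_pi fun i => (finite_Iic (k i)).isCompact
    have hfC : IsCompact (f '' C) := hC.image hf
    refine ⟨f '' C, image_subset_range _ _, hfC, ?_⟩
    -- every open neighbourhood of `f '' C` contains some `f '' B k n`
    have hsub : ∀ U, IsOpen U → f '' C ⊆ U → ∃ n, f '' B k n ⊆ U := by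
      intro U hU hCU
      by_contra! h
      have : ∀ n, ∃ x ∈ B k n, f x ∉ U := fun n => by
        obtain ⟨_, ⟨x, hx, rfl⟩, hxU⟩ := not_subset.1 (h n)
        exact ⟨x, hx, hxU⟩
      choose x hx hxU using this
      -- Truncation moves `x n` into the compact `C` without changing its first `n` coordinates, so
      -- limits of `y` along subsequences are limits of `x`.
      let y : ℕ → (ℕ → ℕ) := fun n i => min (x n i) (k i)
      have hy : ∀ n, y n ∈ C := fun n i _ => mem_Iic.2 (min_le_right (x n i) (k i))
      obtain ⟨z, hz, φ, hφ, hlim⟩ := hC.tendsto_subseq hy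
      have hlim' : Tendsto (x ∘ φ) atTop (𝓝 z) := by
        rw [tendsto_pi_nhds] at hlim ⊢
        intro i
        refine (hlim i).congr' ?_
        filter_upwards [hφ.tendsto_atTop.eventually_gt_atTop i] with n hn
        exact min_eq_left (hx (φ n) i hn)
      have : f z ∈ Uᶜ := hU.isClosed_compl.mem_of_tendsto
        ((hf.tendsto z).comp hlim') (Eventually.of_forall fun n => hxU (φ n))
      exact this (hCU (mem_image_of_mem f hz))
    refine ENNReal.le_of_forall_pos_le_add fun η hη _ => ?_
    obtain ⟨U, hCU, hU, hUlt⟩ := (f '' C).exists_isOpen_lt_add (measure_ne_top μ _)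
      (ENNReal.coe_pos.2 hη).ne'
    obtain ⟨n, hn⟩ := hsub U hU hCU
    calc μ (range f) ≤ μ (f '' B k n) + ∑ i ∈ Finset.range n, δ i := hsum n
      _ ≤ (μ (f '' C) + η) + ε := by
        gcongr
        · exact (measure_mono hn).trans hUlt.le
        · exact (ENNReal.sum_le_tsum _).trans hδε.le
      _ = _ := add_right_comm _ _ _
  obtain ⟨u, -, hu, hu0⟩ := exists_seq_strictAnti_tendsto' (zero_lt_one (α := ℝ≥0∞))
  choose K hKs hK hKμ using fun n => key (u n) (hu n).1
  have hmeas : MeasurableSet (⋃ n, K n) := MeasurableSet.iUnion fun n => (hK n).measurableSet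
  have hle : μ (range f) ≤ μ (⋃ n, K n) := by
    refine ge_of_tendsto' (x := atTop) (f := fun n => μ (⋃ n, K n) + u n) ?_ fun n =>
      (hKμ n).trans (by gcongr; exact subset_iUnion K n)
    simpa using hu0.const_add (μ (⋃ n, K n))
  exact hmeas.nullMeasurableSet.congr (ae_eq_of_subset_of_measure_ge (iUnion_subset hKs) hle
    hmeas.nullMeasurableSet (measure_ne_top _ _))

/-- Analytic sets are measurable with respect to the completion of any σ-finite Borel measure. -/
theorem MeasureTheory.AnalyticSet.nullMeasurableSet {α : Type*}
    [TopologicalSpace α] [TopologicalSpace.MetrizableSpace α] [MeasurableSpace α] [BorelSpace α]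
    {μ : Measure α} [SFinite μ] {s : Set α} (hs : AnalyticSet s) : NullMeasurableSet s μ :=
  (hs.nullMeasurableSet_of_isFiniteMeasure (μ := μ.toFinite)).mono_ac
    (absolutelyContinuous_toFinite μ)

/-! ### Joining points by curves of finite integral. -/

section
variable {X : Type*}

/-- Some `1`-Lipschitz curve of length at most `L` runs from `x` to `y` and has finite integral
of `g`. -/
def Joins (d : MetricSpace X) (g : X → ℝ≥0∞) (L : ℝ) (x y : X) : Prop :=
  ∃ (γ : ℝ → X) (l : ℝ), l ∈ Icc 0 L ∧ LipschitzWith 1 γ ∧ γ 0 = x ∧ γ l = y ∧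
    ∫⁻ t in Icc 0 l, g (γ t) < ∞

namespace Joins

variable {d : MetricSpace X} {g : X → ℝ≥0∞} {L : ℝ} {x y : X}

theorem refl (hL : 0 ≤ L) (x : X) : Joins d g L x x :=
  ⟨fun _ => x, 0, left_mem_Icc.2 hL, LipschitzWith.const' x, rfl, rfl, by simp⟩

theorem mono {L' : ℝ} (h : Joins d g L x y) (hL : L ≤ L') : Joins d g L' x y := by
  obtain ⟨γ, l, hl, h⟩ := h
  exact ⟨γ, l, ⟨hl.1, hl.2.trans hL⟩, h⟩

theorem dist_le (h : Joins d g L x y) : dist x y ≤ L := by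
  obtain ⟨γ, l, hl, hγ, rfl, rfl, -⟩ := h
  refine (hγ.dist_le_mul 0 l).trans ?_
  simpa [Real.dist_eq, abs_of_nonneg hl.1] using hl.2

theorem of_const_mul_le {g' : X → ℝ≥0∞} {c : ℝ≥0∞} (hc : c ≠ 0) (hcg : ∀ x, c * g' x ≤ g x)
    (h : Joins d g L x y) : Joins d g' L x y := by
  obtain ⟨γ, l, hl, hγ, h0, h1, hfin⟩ := h
  refine ⟨γ, l, hl, hγ, h0, h1, ?_⟩
  have := (lintegral_const_mul_le c (fun t => g' (γ t))).trans_lt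
    ((lintegral_mono fun t => hcg (γ t)).trans_lt hfin)
  by_contra htop
  rw [not_lt, top_le_iff] at htop
  rw [htop, ENNReal.mul_top hc] at this
  exact this.false

theorem of_metric_le {ρ : MetricSpace X} (hρ : ∀ x y, d.dist x y ≤ ρ.dist x y)
    (h : Joins ρ g L x y) : Joins d g L x y := by
  obtain ⟨γ, l, hl, hγ, h⟩ := h
  exact ⟨γ, l, hl, @LipschitzWith.of_dist_le_mul ℝ X _ d.toPseudoMetricSpace 1 γ fun s t =>
    (hρ _ _).trans (@LipschitzWith.dist_le_mul ℝ X _ ρ.toPseudoMetricSpace 1 γ hγ s t), h⟩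

theorem of_subcurve {γ : ℝ → X} (hγ : LipschitzWith 1 γ) {l s t : ℝ} (hs : 0 ≤ s) (hst : s ≤ t)
    (ht : t ≤ l) (hfin : ∫⁻ u in Icc 0 l, g (γ u) < ∞) : Joins d g (t - s) (γ s) (γ t) := by
  refine ⟨fun u => γ (s + u), t - s, right_mem_Icc.2 (sub_nonneg.2 hst), ?_, by simp, by simp, ?_⟩
  · exact one_mul (1 : NNReal) ▸ hγ.comp (LipschitzWith.of_dist_le_mul fun a b => by simp)
  · refine (setLIntegral_le_of_subset_image (φ := fun u => u - s) (B := Icc 0 l)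
      ?_ ?_ _).trans_lt ?_
    · exact LipschitzWith.of_dist_le_mul fun a b => by simp
    · exact fun u hu => ⟨u + s, ⟨by linarith [hu.1], by linarith [hu.2]⟩, by simp⟩
    · simpa using hfin

theorem symm (h : Joins d g L x y) : Joins d g L y x := by
  obtain ⟨γ, l, hl, hγ, h0, h1, hfin⟩ := h
  have hlip : LipschitzWith 1 fun u : ℝ => l - u :=
    LipschitzWith.of_dist_le_mul fun a b => by
      rw [dist_sub_left, NNReal.coe_one, one_mul]
  refine ⟨fun u => γ (l - u), l, hl, ?_, by simpa using h1, by simpa using h0, ?_⟩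
  · exact one_mul (1 : NNReal) ▸ hγ.comp hlip
  · refine (setLIntegral_le_of_subset_image hlip (B := Icc 0 l) ?_ _).trans_lt ?_
    · exact fun u hu => ⟨l - u, ⟨by linarith [hu.2], by linarith [hu.1]⟩, by simp⟩
    · simpa using hfin

theorem trans {L' : ℝ} {z : X} (h : Joins d g L x y) (h' : Joins d g L' y z) :
    Joins d g (L + L') x z := by
  obtain ⟨γ, l, hl, hγ, h0, h1, hfin⟩ := h
  obtain ⟨γ', l', hl', hγ', h0', h1', hfin'⟩ := h'
  have hlip : LipschitzWith 1 fun u : ℝ => u + l := LipschitzWith.of_dist_le_mul fun a b => by simp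
  refine ⟨fun u => if u ≤ l then γ u else γ' (u - l), l + l',
    ⟨add_nonneg hl.1 hl'.1, add_le_add hl.2 hl'.2⟩, ?_, by simp [hl.1, h0], ?_, ?_⟩
  · refine LipschitzWith.of_dist_le_mul fun a b => ?_
    wlog hab : a ≤ b generalizing a b
    · rw [dist_comm, dist_comm a]
      exact this b a (not_le.1 hab).le
    have e1 := hγ.dist_le_mul
    have e2 := hγ'.dist_le_mul
    simp only [NNReal.coe_one, one_mul, Real.dist_eq] at e1 e2 ⊢
    by_cases hb : b ≤ l
    · simpa [hb, hab.trans hb] using e1 a b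
    by_cases ha : a ≤ l
    · simp only [ha, hb, if_true, if_false]
      have e3 := e1 a l
      have e4 := e2 0 (b - l)
      rw [h1] at e3
      rw [h0'] at e4
      refine (dist_triangle _ y _).trans ((add_le_add e3 e4).trans_eq ?_)
      rw [abs_of_nonpos (by linarith), abs_of_nonpos (by linarith), abs_of_nonpos (by linarith)]
      ring
    · simpa [ha, hb] using e2 (a - l) (b - l)
  · rcases hl'.1.eq_or_lt with h | h
    · subst h
      simp [h1, ← h1', h0']
    · simp [h, h1']
  · have hsub : Icc 0 (l + l') ⊆ Icc 0 l ∪ Ioc l (l + l') := fun u hu =>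
      (le_or_gt u l).imp (fun h => ⟨hu.1, h⟩) fun h => ⟨h, hu.2⟩
    refine (lintegral_mono_set hsub).trans_lt ((lintegral_union_le _ _ _).trans_lt
      (ENNReal.add_lt_top.2 ⟨?_, ?_⟩))
    · refine lt_of_eq_of_lt (setLIntegral_congr_fun measurableSet_Icc fun u hu => ?_) hfin
      simp [hu.2]
    · refine lt_of_le_of_lt ?_ hfin'
      calc ∫⁻ u in Ioc l (l + l'), g (if u ≤ l then γ u else γ' (u - l))
          = ∫⁻ u in Ioc l (l + l'), g (γ' (u - l)) :=
            setLIntegral_congr_fun measurableSet_Ioc fun u hu => by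
              simp only [if_neg (not_le.2 hu.1)]
        _ ≤ ∫⁻ u in Icc 0 l', g (γ' (u + l - l)) :=
            setLIntegral_le_of_subset_image hlip (B := Icc 0 l')
              (fun u hu => ⟨u - l, ⟨by linarith [hu.1], by linarith [hu.2]⟩, by simp⟩) _
        _ = _ := by simp only [add_sub_cancel_right]

/-- The set of points which are joined to a Borel set is analytic. -/
theorem analyticSet [ProperSpace X] [MeasurableSpace X] [BorelSpace X] (hg : Measurable g)
    {E : Set X} (hE : MeasurableSet E) (L : ℝ) : AnalyticSet {y | ∃ x ∈ E, Joins d g L x y} := by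
  rcases lt_or_ge L 0 with hL | hL
  · convert analyticSet_empty
    refine eq_empty_of_forall_notMem ?_
    rintro y ⟨x, -, γ, l, hl, -⟩
    exact hL.not_ge (hl.1.trans hl.2)
  let : MeasurableSpace C(Icc 0 L, X) := borel _
  have : BorelSpace C(Icc 0 L, X) := ⟨rfl⟩
  have : SecondCountableTopology X := inferInstance
  have : PolishSpace C(Icc 0 L, X) := inferInstance
  -- The indicator replaces the variable endpoint of integration by the fixed `L`, so the integral
  -- is measurable in the pair (curve, endpoint). The target set is then the image, under
  -- evaluation, of a Borel subset of a Polish space.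
  let F : (C(Icc 0 L, X) × Icc 0 L) × ℝ → ℝ≥0∞ := fun p =>
    indicator {q : (C(Icc 0 L, X) × Icc 0 L) × ℝ | q.2 ≤ q.1.2}
      (fun q => g (q.1.1 (projIcc 0 L hL q.2))) p
  have hF : Measurable F := by
    refine Measurable.indicator (hg.comp (Continuous.measurable ?_)) (IsClosed.measurableSet ?_)
    · have : Continuous (projIcc 0 L hL) := continuous_projIcc
      fun_prop
    · exact isClosed_le (by fun_prop) (by fun_prop)
  let S : Set (C(Icc 0 L, X) × Icc 0 L) := {p | LipschitzWith 1 p.1} ∩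
    ({p | p.1 ⟨0, left_mem_Icc.2 hL⟩ ∈ E} ∩ {p | ∫⁻ t in Icc 0 L, F (p, t) < ∞})
  have hS : MeasurableSet S := by
    refine MeasurableSet.inter (IsClosed.measurableSet ?_) (MeasurableSet.inter ?_ ?_)
    · simp only [lipschitzWith_iff_dist_le_mul, ofPred_forall]
      refine isClosed_iInter fun a => isClosed_iInter fun b => isClosed_le ?_ ?_
      · fun_prop
      · fun_prop
    · refine (Continuous.measurable ?_) hE
      fun_prop
    · exact measurableSet_lt hF.lintegral_prod_right' measurable_const
  have hcont : Continuous fun p : C(Icc 0 L, X) × Icc 0 L => p.1 p.2 := by fun_prop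
  have hFint : ∀ (γ : C(Icc 0 L, X)) (l : Icc 0 L), ∫⁻ t in Icc 0 L, F ((γ, l), t) =
      ∫⁻ t in Icc (0 : ℝ) l, g (γ (projIcc 0 L hL t)) := by
    intro γ l
    have hset : Iic (l : ℝ) ∩ Icc 0 L = Icc (0 : ℝ) l := by
      ext t
      exact ⟨fun h => ⟨h.2.1, h.1⟩, fun h => ⟨h.2, h.1, h.2.trans l.2.2⟩⟩
    rw [← hset, ← setLIntegral_indicator measurableSet_Iic]
    rfl
  convert hS.analyticSet_image hcont.measurable using 1
  ext y
  constructor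
  · rintro ⟨x, hx, γ, l, hl, hγ, h0, h1, hfin⟩
    refine ⟨(⟨fun t => γ t, hγ.continuous.comp continuous_subtype_val⟩, ⟨l, hl⟩),
      ⟨?_, ?_, ?_⟩, h1⟩
    · have := hγ.comp (LipschitzWith.subtype_val (Icc 0 L))
      rw [one_mul] at this
      exact this
    · simpa [h0] using hx
    · rw [mem_ofPred_eq, hFint]
      refine lt_of_eq_of_lt (setLIntegral_congr_fun measurableSet_Icc fun t ht => ?_) hfin
      simp [coe_projIcc, ht.1, ht.2.trans hl.2]
  · rintro ⟨⟨γ, l⟩, ⟨hγ, h0, hfin⟩, rfl⟩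
    refine ⟨_, h0, fun t => γ (projIcc 0 L hL t), l, l.2, ?_, ?_, ?_, ?_⟩
    · exact one_mul (1 : NNReal) ▸ hγ.comp (LipschitzWith.projIcc hL)
    · simp [projIcc_left]
    · simp
    · rw [← hFint]
      exact hfin

end Joins
end

/-! ### Weights and families of modulus zero. -/

theorem mul_lineIntegral_le {X : Type*} (d : MetricSpace X) {g G : X → ℝ≥0∞} {c : ℝ≥0∞}
    (h : ∀ x, c * g x ≤ G x) (γ : I → X) : c * lineIntegral d g γ ≤ lineIntegral d G γ := by
  unfold lineIntegral
  split_ifs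
  · exact (lintegral_const_mul_le _ _).trans (lintegral_mono fun t => h _)
  · exact le_top

section
variable {X : Type*} [MeasurableSpace X] {μ : Measure X} {p : ℝ≥0∞}

open Classical in
/-- The quantity which is minimized in the definition of the `p`-modulus. -/
noncomputable def modulusCost (p : ℝ≥0∞) (μ : Measure X) (g : X → ℝ≥0∞) : ℝ≥0∞ :=
  if p = ∞ then essSup g μ else ∫⁻ x, g x ^ p.toReal ∂μ

theorem modulus_eq_iInf_modulusCost (d : MetricSpace X) (Γ : Set (I → X)) :
    modulus d μ p Γ = ⨅ (g : X → ℝ≥0∞) (_ : IsAdmissible d Γ g), modulusCost p μ g := by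
  by_cases h : p = ∞ <;> simp [modulus, modulusCost, h]

/-- The power of a supremum is at most the sum of the powers. Combining weights by suprema rather
than sums thus avoids Minkowski's inequality. -/
theorem modulusCost_iSup_le (hp : p ≠ 0) {g : ℕ → X → ℝ≥0∞} (hg : ∀ n, Measurable (g n)) :
    modulusCost p μ (fun x => ⨆ n, g n x) ≤ ∑' n, modulusCost p μ (g n) := by
  by_cases h : p = ∞
  · simp only [modulusCost, h, if_true]
    refine essSup_le_of_ae_le _ ?_
    filter_upwards [ae_all_iff.2 fun n => ENNReal.ae_le_essSup (μ := μ) (g n)] with x hx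
    exact iSup_le fun n => (hx n).trans (ENNReal.le_tsum n)
  · simp only [modulusCost, h, if_false]
    rw [← lintegral_tsum fun n => ((hg n).pow_const _).aemeasurable]
    refine lintegral_mono fun x => ?_
    have hpos : 0 < p.toReal := ENNReal.toReal_pos hp h
    rw [← ENNReal.le_rpow_inv_iff hpos]
    refine iSup_le fun n => ?_
    rw [ENNReal.le_rpow_inv_iff hpos]
    exact ENNReal.le_tsum (f := fun n => g n x ^ p.toReal) n

/-- The behaviour of `modulusCost` under multiplication by constants. -/
theorem exists_modulusCost_const_mul_le {c : ℝ≥0∞} (hc : c ≠ ∞) :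
    ∃ C : ℝ≥0∞, C ≠ ∞ ∧ ∀ g : X → ℝ≥0∞, Measurable g →
      modulusCost p μ (fun x => c * g x) ≤ C * modulusCost p μ g := by
  by_cases h : p = ∞
  · simp only [modulusCost, h, if_true]
    exact ⟨c, hc, fun g _ => ENNReal.essSup_const_mul.le⟩
  · simp only [modulusCost, h, if_false]
    refine ⟨c ^ p.toReal, ENNReal.rpow_ne_top_of_nonneg ENNReal.toReal_nonneg hc, fun g hg => ?_⟩
    simp only [ENNReal.mul_rpow_of_nonneg _ _ ENNReal.toReal_nonneg]
    rw [lintegral_const_mul _ (hg.pow_const _)]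

theorem exists_const_mul_modulusCost_le (hp : p ≠ 0) {g : X → ℝ≥0∞} (hg : Measurable g)
    (hfin : modulusCost p μ g < ∞) {ε : ℝ≥0∞} (hε : ε ≠ 0) :
    ∃ c : ℝ≥0∞, c ≠ 0 ∧ modulusCost p μ (fun x => c * g x) ≤ ε := by
  by_cases h : p = ∞
  · simp only [modulusCost, h, if_true] at hfin ⊢
    obtain ⟨c, hc, hcε⟩ := ENNReal.exists_nnreal_pos_mul_lt hfin.ne hε
    exact ⟨c, by exact_mod_cast hc.ne', ENNReal.essSup_const_mul.trans_le hcε.le⟩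
  · simp only [modulusCost, h, if_false] at hfin ⊢
    have hpos : 0 < p.toReal := ENNReal.toReal_pos hp h
    obtain ⟨c, hc, hcε⟩ := ENNReal.exists_nnreal_pos_mul_lt hfin.ne hε
    refine ⟨(c : ℝ≥0∞) ^ (p.toReal)⁻¹, ?_, ?_⟩
    · simp [ENNReal.rpow_eq_zero_iff, hc.ne', hpos.not_gt, inv_neg'', hpos]
    · simp only [ENNReal.mul_rpow_of_nonneg _ _ hpos.le]
      rw [lintegral_const_mul _ (hg.pow_const _), ENNReal.rpow_inv_rpow hpos.ne']
      exact hcε.le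

/-- Borel functions of finite cost; those curves along which the integral of such a function is
infinite form a family of vanishing `p`-modulus. -/
def IsModulusWeight (p : ℝ≥0∞) (μ : Measure X) (g : X → ℝ≥0∞) : Prop :=
  Measurable g ∧ modulusCost p μ g < ∞

theorem IsModulusWeight.zero (hp : p ≠ 0) : IsModulusWeight p μ (fun _ => 0) := by
  refine ⟨measurable_const, ?_⟩
  by_cases h : p = ∞
  · simp only [modulusCost, h, if_true]
    exact (essSup_const_bot (μ := μ) (β := ℝ≥0∞)).trans_lt ENNReal.zero_lt_top
  · simp [modulusCost, h, ENNReal.zero_rpow_of_pos (ENNReal.toReal_pos hp h)]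

/-- This weight excludes the curves that spend positive time in a null set. -/
theorem IsModulusWeight.indicator_top (hp : p ≠ 0) {N : Set X} (hN : MeasurableSet N)
    (h0 : μ N = 0) : IsModulusWeight p μ (N.indicator fun _ => ∞) := by
  refine ⟨measurable_const.indicator hN, ?_⟩
  have hae : (N.indicator fun _ => (∞ : ℝ≥0∞)) =ᵐ[μ] fun _ => 0 :=
    indicator_meas_zero h0
  have : modulusCost p μ (N.indicator fun _ => ∞) = modulusCost p μ (fun _ => 0) := by
    by_cases h : p = ∞
    · simp only [modulusCost, h, if_true]
      exact essSup_congr_ae hae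
    · simp only [modulusCost, h, if_false]
      exact lintegral_congr_ae (hae.mono fun x hx => by simp only [hx])
  rw [this]
  exact (IsModulusWeight.zero hp).2

/-- Countably many weights are dominated by a single one, up to constants. -/
theorem IsModulusWeight.exists_dominating (hp : p ≠ 0) {g : ℕ → X → ℝ≥0∞}
    (hg : ∀ n, IsModulusWeight p μ (g n)) :
    ∃ G, IsModulusWeight p μ G ∧ ∀ n, ∃ c : ℝ≥0∞, c ≠ 0 ∧ ∀ x, c * g n x ≤ G x := by
  obtain ⟨δ, hδ, hsum⟩ := ENNReal.exists_pos_sum_of_countable' one_ne_zero ℕ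
  choose c hc hcost using fun n =>
    exists_const_mul_modulusCost_le hp (hg n).1 (hg n).2 (hδ n).ne'
  refine ⟨fun x => ⨆ n, c n * g n x, ⟨Measurable.iSup fun n => (hg n).1.const_mul _, ?_⟩,
    fun n => ⟨c n, hc n, fun x => le_iSup (fun n => c n * g n x) n⟩⟩
  calc _ ≤ ∑' n, modulusCost p μ (fun x => c n * g n x) :=
        modulusCost_iSup_le hp fun n => (hg n).1.const_mul _
    _ ≤ ∑' n, δ n := ENNReal.tsum_le_tsum hcost
    _ < ∞ := hsum.trans ENNReal.one_lt_top

theorem IsModulusWeight.exists_dominating₂ (hp : p ≠ 0) {g h : X → ℝ≥0∞}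
    (hg : IsModulusWeight p μ g) (hh : IsModulusWeight p μ h) :
    ∃ G, IsModulusWeight p μ G ∧ (∃ c : ℝ≥0∞, c ≠ 0 ∧ ∀ x, c * g x ≤ G x) ∧
      ∃ c : ℝ≥0∞, c ≠ 0 ∧ ∀ x, c * h x ≤ G x := by
  obtain ⟨G, hG, hdom⟩ := exists_dominating hp (g := fun n => if n = 0 then g else h) (μ := μ)
    fun n => by split_ifs <;> assumption
  exact ⟨G, hG, hdom 0, hdom 1⟩

/-- Admissible `g n` of rapidly decreasing cost combine to `⨆ n, n * g n`, of finite cost and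
infinite integral along `Γ`. Conversely, small multiples of a weight with infinite integrals remain
admissible. -/
theorem modulus_eq_zero_iff (hp : p ≠ 0) (d : MetricSpace X) (Γ : Set (I → X)) :
    modulus d μ p Γ = 0 ↔ ∃ g, IsModulusWeight p μ g ∧ ∀ γ ∈ Γ, lineIntegral d g γ = ∞ := by
  rw [modulus_eq_iInf_modulusCost]
  constructor
  · intro h
    obtain ⟨δ, hδ, hsum⟩ := ENNReal.exists_pos_sum_of_countable' one_ne_zero ℕ
    choose C hC hCle using fun n : ℕ =>
      exists_modulusCost_const_mul_le (X := X) (μ := μ) (p := p) (ENNReal.natCast_ne_top n)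
    have hex : ∀ n, ∃ g, IsAdmissible d Γ g ∧ C n * modulusCost p μ g ≤ δ n := by
      intro n
      obtain ⟨ε, hε, hεδ⟩ := ENNReal.exists_nnreal_pos_mul_lt (hC n) (hδ n).ne'
      have : (⨅ (g : X → ℝ≥0∞) (_ : IsAdmissible d Γ g), modulusCost p μ g) < ε := by
        rw [h]
        exact_mod_cast hε
      simp only [iInf_lt_iff] at this
      obtain ⟨g, hg, hlt⟩ := this
      refine ⟨g, hg, le_trans ?_ hεδ.le⟩
      rw [mul_comm]
      gcongr
    choose g hg hcost using hex
    refine ⟨fun x => ⨆ n : ℕ, n * g n x, ⟨Measurable.iSup fun n => (hg n).1.const_mul _, ?_⟩,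
      fun γ hγ => ?_⟩
    · calc _ ≤ ∑' n : ℕ, modulusCost p μ (fun x => n * g n x) :=
            modulusCost_iSup_le hp fun n => (hg n).1.const_mul _
        _ ≤ ∑' n, δ n := ENNReal.tsum_le_tsum fun n => (hCle n _ (hg n).1).trans (hcost n)
        _ < ∞ := hsum.trans ENNReal.one_lt_top
    · refine ENNReal.eq_top_of_forall_nnreal_le fun r => ?_
      obtain ⟨n, hn⟩ := exists_nat_ge r
      calc (r : ℝ≥0∞) ≤ n * 1 := by rw [mul_one]; exact_mod_cast hn
        _ ≤ n * lineIntegral d (g n) γ := by gcongr; exact (hg n).2 γ hγ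
        _ ≤ _ := mul_lineIntegral_le d (fun x => le_iSup (fun n : ℕ => n * g n x) n) γ
  · rintro ⟨g, hg, hΓ⟩
    refine le_antisymm (le_of_forall_pos_le_add fun ε hε => ?_) zero_le
    obtain ⟨c, hc, hcost⟩ := exists_const_mul_modulusCost_le hp hg.1 hg.2 hε.ne'
    rw [zero_add]
    refine (iInf₂_le (fun x => c * g x) ⟨hg.1.const_mul c, fun γ hγ => ?_⟩).trans hcost
    have := mul_lineIntegral_le d (fun x => le_refl (c * g x)) γ
    rw [hΓ γ hγ, ENNReal.mul_top hc, top_le_iff] at this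
    rw [this]
    exact le_top

/-- Thick quasiconvexity in terms of Lipschitz curves. -/
theorem thickQuasiconvex_iff (hp : p ≠ 0) (d : MetricSpace X) {C : ℝ} (hC : 0 ≤ C) :
    ThickQuasiconvex d μ p C ↔ ∀ E F : Set X, NullMeasurableSet E μ → NullMeasurableSet F μ →
      0 < μ E → 0 < μ F → ∀ g, IsModulusWeight p μ g →
        ∃ x ∈ E, ∃ y ∈ F, Joins d g (C * d.dist x y) x y := by
  have hnonneg : ∀ x y, 0 ≤ C * d.dist x y := fun x y => mul_nonneg hC dist_nonneg
  refine forall_congr' fun E => forall_congr' fun F => forall_congr' fun hE =>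
    forall_congr' fun hF => forall_congr' fun hE0 => forall_congr' fun hF0 => ?_
  rw [pos_iff_ne_zero, Ne, modulus_eq_zero_iff hp]
  push Not
  refine forall_congr' fun g => forall_congr' fun hg => ?_
  constructor
  · rintro ⟨γ, ⟨hγ, h0, h1, hl⟩, hfin⟩
    obtain ⟨η, hη, hη0, hη1, hηfin⟩ := exists_lipschitz_parametrization d hγ
      (hl.trans_lt ENNReal.ofReal_lt_top) hfin.lt_top
    exact ⟨_, h0, _, h1, η, _, ⟨ENNReal.toReal_nonneg,
      ENNReal.toReal_le_of_le_ofReal (hnonneg _ _) hl⟩, hη, hη0, hη1, hηfin⟩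
  · rintro ⟨x, hx, y, hy, γ, l, hl, hγ, rfl, rfl, hfin⟩
    obtain ⟨hc, hlen, hint⟩ := curveLength_le_and_lineIntegral_le d hl.1 hγ.lipschitzOnWith g
    refine ⟨_, ⟨hc, ?_, ?_, ?_⟩, (hint.trans_lt hfin).ne⟩
    · simpa using hx
    · simpa using hy
    · refine hlen.trans (ENNReal.ofReal_le_ofReal ?_)
      simpa using hl.2

end

/-! ### Change of metric and distance along good curves. -/

/-- Every subcurve of a good curve is good, so the bound on `ρ` applies between any two of its
points and makes the curve `1`-Lipschitz for `ρ`. -/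
theorem Joins.of_dist_le {X : Type*} {d ρ : MetricSpace X} {g : X → ℝ≥0∞}
    (hρ : ∀ x y L, Joins d g L x y → ρ.dist x y ≤ L) {L : ℝ} {x y : X} (h : Joins d g L x y) :
    Joins ρ g L x y := by
  obtain ⟨γ, l, hl, hγ, rfl, rfl, hfin⟩ := h
  have hlip : @LipschitzOnWith ℝ X _ ρ.toPseudoEMetricSpace 1 γ (Icc 0 l) := by
    refine @LipschitzOnWith.of_dist_le_mul ℝ X _ ρ.toPseudoMetricSpace 1 _ γ fun s hs t ht => ?_
    wlog hst : s ≤ t generalizing s t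
    · rw [@dist_comm X ρ.toPseudoMetricSpace, dist_comm s]
      exact this t ht s hs (not_le.1 hst).le
    refine (hρ _ _ _ (Joins.of_subcurve hγ hs.1 hst ht.2 hfin)).trans_eq ?_
    rw [NNReal.coe_one, one_mul, dist_comm, Real.dist_eq, abs_of_nonneg (sub_nonneg.2 hst)]
  have hproj : ∀ t ∈ Icc 0 l, γ (projIcc 0 l hl.1 t) = γ t := fun t ht => by
    rw [projIcc_of_mem hl.1 ht]
  refine ⟨fun t => γ (projIcc 0 l hl.1 t), l, hl,
    @LipschitzOnWith.comp_projIcc X ρ.toPseudoEMetricSpace _ _ _ _ hlip hl.1,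
    hproj 0 (left_mem_Icc.2 hl.1), hproj l (right_mem_Icc.2 hl.1), ?_⟩
  refine lt_of_eq_of_lt (setLIntegral_congr_fun measurableSet_Icc fun t ht => ?_) hfin
  beta_reduce
  rw [hproj t ht]

section
variable {X : Type*}

/-- The distance from `E` along curves with finite integral of `g`, truncated at height `M`. -/
noncomputable def truncatedDist (d : MetricSpace X) (g : X → ℝ≥0∞) (E : Set X) (M : ℝ) (y : X) :
    ℝ :=
  sInf (insert M {L | ∃ x ∈ E, Joins d g L x y})

section
variable {d : MetricSpace X} {g : X → ℝ≥0∞} {E : Set X} {M : ℝ}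

theorem bddBelow_truncatedDist (hM : 0 ≤ M) (y : X) :
    BddBelow (insert M {L | ∃ x ∈ E, Joins d g L x y}) := by
  refine ⟨0, ?_⟩
  rintro L (rfl | ⟨x, -, γ, l, hl, -⟩)
  · exact hM
  · exact hl.1.trans hl.2

theorem truncatedDist_lt_iff (hM : 0 ≤ M) {y : X} {a : ℝ} :
    truncatedDist d g E M y < a ↔ M < a ∨ ∃ L < a, ∃ x ∈ E, Joins d g L x y := by
  rw [truncatedDist, csInf_lt_iff (bddBelow_truncatedDist hM y) (insert_nonempty _ _)]
  simp only [mem_insert_iff, mem_ofPred_eq]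
  constructor
  · rintro ⟨L, rfl | h, hL⟩
    exacts [Or.inl hL, Or.inr ⟨L, hL, h⟩]
  · rintro (h | ⟨L, hL, h⟩)
    exacts [⟨M, Or.inl rfl, h⟩, ⟨L, Or.inr h, hL⟩]

/-- Good curves can be concatenated and reversed; hence `1` is an upper gradient, with `g` as
exceptional weight. -/
theorem abs_truncatedDist_sub_le (hM : 0 ≤ M) {x y : X} {L : ℝ} (h : Joins d g L x y) :
    |truncatedDist d g E M x - truncatedDist d g E M y| ≤ L := by
  have key : ∀ x y, Joins d g L x y → truncatedDist d g E M y ≤ truncatedDist d g E M x + L := by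
    intro x y h
    rw [← sub_le_iff_le_add]
    have hL : 0 ≤ L := dist_nonneg.trans h.dist_le
    refine le_csInf (insert_nonempty _ _) ?_
    rintro s (rfl | ⟨z, hz, hs⟩)
    · have := csInf_le (bddBelow_truncatedDist (d := d) (g := g) (E := E) hM y) (mem_insert _ _)
      rw [truncatedDist]
      linarith
    · rw [sub_le_iff_le_add]
      exact csInf_le (bddBelow_truncatedDist hM y) (mem_insert_of_mem _ ⟨z, hz, hs.trans h⟩)
  rw [abs_le]
  constructor <;> linarith [key x y h, key y x h.symm]

end

theorem continuous_id_of_dist_le_mul {d ρ : MetricSpace X} {C : ℝ} (hC : 0 ≤ C)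
    (h : ∀ x y, ρ.dist x y ≤ C * d.dist x y) :
    d.toUniformSpace.toTopologicalSpace ≤ ρ.toUniformSpace.toTopologicalSpace :=
  continuous_id_iff_le.1 (@LipschitzWith.continuous X X d.toPseudoEMetricSpace
    ρ.toPseudoEMetricSpace ⟨C, hC⟩ id
    (@LipschitzWith.of_dist_le_mul X X d.toPseudoMetricSpace ρ.toPseudoMetricSpace ⟨C, hC⟩ id h))

variable [MeasurableSpace X] {μ : Measure X}

theorem IsMetricMeasureSpace.of_dist_le {d ρ : MetricSpace X} (hX : IsMetricMeasureSpace d μ)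
    {C : ℝ} (hC : 0 < C) (h1 : ∀ x y, d.dist x y ≤ ρ.dist x y)
    (h2 : ∀ x y, ρ.dist x y ≤ C * d.dist x y) : IsMetricMeasureSpace ρ μ := by
  have htop : d.toUniformSpace.toTopologicalSpace = ρ.toUniformSpace.toTopologicalSpace :=
    le_antisymm (continuous_id_of_dist_le_mul hC.le h2)
      (continuous_id_of_dist_le_mul zero_le_one (by simpa using h1))
  refine ⟨?_, ?_, fun x r hr => ?_, fun x r => ?_⟩
  · refine @ProperSpace.mk X ρ.toPseudoMetricSpace fun x r => ?_
    have hK := @isCompact_closedBall X d.toPseudoMetricSpace hX.proper x r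
    rw [htop] at hK
    refine @IsCompact.of_isClosed_subset X ρ.toUniformSpace.toTopologicalSpace _ _ hK
      (@Metric.isClosed_closedBall X ρ.toPseudoMetricSpace x r) fun y hy => ?_
    exact (h1 y x).trans hy
  · have := hX.borel
    rwa [htop] at this
  · refine (hX.ball_pos x (r / C) (div_pos hr hC)).trans_le (measure_mono fun y hy => ?_)
    have : d.dist y x < r / C := hy
    refine (h2 y x).trans_lt ?_
    rwa [lt_div_iff₀' hC] at this
  · exact (measure_mono fun y hy => (h1 y x).trans_lt hy).trans_lt (hX.ball_lt_top x r)

/-! ### The Sobolev-to-Lipschitz property. -/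

variable {p : ℝ≥0∞}

/-- Up to a family of curves of vanishing `p`-modulus, `f` is `1`-Lipschitz along curves, i.e.
the constant `1` is a `p`-weak upper gradient of `f`. -/
def HasUnitUpperGradient (d : MetricSpace X) (μ : Measure X) (p : ℝ≥0∞) (f : X → ℝ) : Prop :=
  ∃ g, IsModulusWeight p μ g ∧ ∀ x y L, Joins d g L x y → |f x - f y| ≤ L

/-- Balls in `X × ℝ` around graph points control position and value together. Good curves join their
preimages, and the inequality, closed in the pair of graph points, survives the limit. -/
theorem abs_sub_le_of_thickQuasiconvex (hp : p ≠ 0) {d : MetricSpace X} {C : ℝ} (hC : 0 ≤ C)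
    (hthick : ThickQuasiconvex d μ p C) {f : X → ℝ} (hf : HasUnitUpperGradient d μ p f)
    (hmeas : ∀ z : X × ℝ, ∀ ε > 0, NullMeasurableSet {x | (x, f x) ∈ Metric.ball z ε} μ)
    {x y : X} (hx : ∀ ε > 0, 0 < μ {z | (z, f z) ∈ Metric.ball (x, f x) ε})
    (hy : ∀ ε > 0, 0 < μ {z | (z, f z) ∈ Metric.ball (y, f y) ε}) :
    |f x - f y| ≤ C * d.dist x y := by
  obtain ⟨g, hg, hfg⟩ := hf
  let S : Set ((X × ℝ) × (X × ℝ)) := {q | |q.1.2 - q.2.2| ≤ C * dist q.1.1 q.2.1}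
  have hS : IsClosed S := isClosed_le (by fun_prop) (by fun_prop)
  suffices ((x, f x), (y, f y)) ∈ closure S by
    rw [hS.closure_eq] at this
    exact this
  refine Metric.mem_closure_iff.2 fun ε hε => ?_
  obtain ⟨z, hz, w, hw, hj⟩ := (thickQuasiconvex_iff hp d hC).1 hthick _ _ (hmeas _ ε hε)
    (hmeas _ ε hε) (hx ε hε) (hy ε hε) g hg
  refine ⟨((z, f z), (w, f w)), hfg _ _ _ hj, ?_⟩
  rw [Prod.dist_eq]
  exact max_lt (by rw [dist_comm]; exact hz) (by rw [dist_comm]; exact hw)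

theorem HasUnitUpperGradient.abs_sub_le (hp : p ≠ 0) {d : MetricSpace X}
    (hX : IsMetricMeasureSpace d μ) {C : ℝ} (hC : 0 ≤ C) (hthick : ThickQuasiconvex d μ p C)
    {f : X → ℝ} (hf : HasUnitUpperGradient d μ p f) (hcont : Continuous f) (x y : X) :
    |f x - f y| ≤ C * d.dist x y := by
  have := hX.borel
  have hopen : ∀ z : X × ℝ, ∀ ε, IsOpen {x | (x, f x) ∈ Metric.ball z ε} := fun z ε =>
    Metric.isOpen_ball.preimage (by fun_prop : Continuous fun x => (x, f x))
  have hpos : ∀ x, ∀ ε > 0, 0 < μ {z | (z, f z) ∈ Metric.ball (x, f x) ε} := fun x ε hε => by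
    obtain ⟨δ, hδ, hsub⟩ := Metric.isOpen_iff.1 (hopen (x, f x) ε) x (Metric.mem_ball_self hε)
    exact (hX.ball_pos x δ hδ).trans_le (measure_mono hsub)
  exact abs_sub_le_of_thickQuasiconvex hp hC hthick hf
    (fun z ε _ => (hopen z ε).measurableSet.nullMeasurableSet) (hpos x) (hpos y)

/-- The Sobolev-to-Lipschitz property of thick quasiconvex spaces. -/
theorem HasUnitUpperGradient.exists_continuous_ae_eq (hp : p ≠ 0) {d : MetricSpace X}
    (hX : IsMetricMeasureSpace d μ) {C : ℝ} (hC : 0 ≤ C) (hthick : ThickQuasiconvex d μ p C)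
    {f : X → ℝ} (hf : HasUnitUpperGradient d μ p f) (hmeas : AEMeasurable f μ) :
    ∃ f' : X → ℝ, Continuous f' ∧ HasUnitUpperGradient d μ p f' ∧ f' =ᵐ[μ] f := by
  have := hX.borel
  have := hX.proper
  have hΦ : AEMeasurable (fun x => (x, f x)) μ := aemeasurable_id.prodMk hmeas
  -- `N` consists of the points whose graph point lies outside the support of the image of `μ` on
  -- the graph.
  let N : Set X := ⋃ U ∈ {U ∈ TopologicalSpace.countableBasis (X × ℝ) |
    μ {x | (x, f x) ∈ U} = 0}, {x | (x, f x) ∈ U}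
  have hN : μ N = 0 := (measure_biUnion_null_iff
    ((TopologicalSpace.countable_countableBasis _).mono (sep_subset _ _))).2 fun U hU => hU.2
  have hpos : ∀ x ∉ N, ∀ ε > 0, 0 < μ {z | (z, f z) ∈ Metric.ball (x, f x) ε} := by
    intro x hx ε hε
    obtain ⟨U, hU, hxU, hsub⟩ := (TopologicalSpace.isBasis_countableBasis
      (X × ℝ)).exists_subset_of_mem_open (Metric.mem_ball_self hε : (x, f x) ∈ _) Metric.isOpen_ball
    refine lt_of_lt_of_le (pos_iff_ne_zero.2 fun h0 => hx ?_)
      (measure_mono fun z (hz : (z, f z) ∈ U) => hsub hz)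
    exact mem_biUnion (show U ∈ {U ∈ _ | _} from ⟨hU, h0⟩) hxU
  have hlip : LipschitzOnWith ⟨C, hC⟩ f Nᶜ := LipschitzOnWith.of_dist_le_mul fun x hx y hy =>
    abs_sub_le_of_thickQuasiconvex hp hC hthick hf
      (fun z ε _ => hΦ.nullMeasurable Metric.isOpen_ball.measurableSet) (hpos x hx) (hpos y hy)
  obtain ⟨f', hf', heq⟩ := hlip.extend_real
  have hae : f' =ᵐ[μ] f := by
    filter_upwards [measure_eq_zero_iff_ae_notMem.1 hN] with x hx
    exact (heq hx).symm
  refine ⟨f', hf'.continuous, ?_, hae⟩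
  obtain ⟨g, hg, hfg⟩ := hf
  -- `G` is infinite on `N`, so along a curve with finite `G`-integral `f = f'` at almost every
  -- time.
  obtain ⟨G, hG, ⟨c, hc, hcg⟩, ⟨c', hc', hcg'⟩⟩ := hg.exists_dominating₂ hp
    (IsModulusWeight.indicator_top hp (measurableSet_toMeasurable μ N)
      ((measure_toMeasurable N).trans hN))
  refine ⟨G, hG, ?_⟩
  rintro _ _ L ⟨γ, l, hl, hγ, rfl, rfl, hfin⟩
  rcases hl.1.eq_or_lt with rfl | hl0
  · simpa using hl.2
  have hgood : ∀ t ∈ Icc 0 l, G (γ t) < ∞ → f (γ t) = f' (γ t) := by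
    intro t _ hlt
    refine heq fun htN => hlt.not_ge ?_
    have := hcg' (γ t)
    rwa [indicator_of_mem (subset_toMeasurable μ N htN), ENNReal.mul_top hc'] at this
  have hdense : Dense {t : ℝ | t ∈ Icc 0 l → G (γ t) < ∞} := by
    refine Measure.dense_of_ae (μ := volume) ?_
    rw [← ae_restrict_iff' measurableSet_Icc]
    exact ae_lt_top (hG.1.comp hγ.continuous.measurable) hfin.ne
  refine le_of_forall_pos_le_add fun ε hε => ?_
  -- Good times `s < t` are chosen within `δ` of the two ends. There the `C`-Lipschitz bound costs
  -- at most `2 * C * δ ≤ ε`; the `+ 1` covers `C = 0`.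
  have hδ : 0 < ε / (2 * C + 1) := by positivity
  set δ := ε / (2 * C + 1) with hδdef
  have hδε : δ * (2 * C + 1) = ε := div_mul_cancel₀ _ (by positivity)
  obtain ⟨s, hs, hs0, hsl⟩ := hdense.exists_between (lt_min hδ hl0)
  rw [lt_min_iff] at hsl
  obtain ⟨t, ht, hts, htl⟩ := hdense.exists_between (max_lt hsl.2 (sub_lt_self l hδ))
  rw [max_lt_iff] at hts
  have hsm : s ∈ Icc 0 l := ⟨hs0.le, hsl.2.le⟩
  have htm : t ∈ Icc 0 l := ⟨hs0.le.trans hts.1.le, htl.le⟩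
  have hmid : |f' (γ s) - f' (γ t)| ≤ t - s := by
    rw [← hgood s hsm (hs hsm), ← hgood t htm (ht htm)]
    exact hfg _ _ _ ((Joins.of_subcurve hγ hs0.le hts.1.le htl.le hfin).of_const_mul_le hc hcg)
  have hend : ∀ a b : ℝ, |f' (γ a) - f' (γ b)| ≤ C * |a - b| := fun a b =>
    (hf'.dist_le_mul _ _).trans (mul_le_mul_of_nonneg_left
      ((hγ.dist_le_mul a b).trans_eq (one_mul _)) hC)
  have e1 := hend 0 s
  have e2 := hend t l
  have ha1 : |0 - s| = s := by rw [zero_sub, abs_neg, abs_of_pos hs0]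
  have ha2 : |t - l| = l - t := by rw [abs_sub_comm, abs_of_pos (sub_pos.2 htl)]
  rw [ha1] at e1
  rw [ha2] at e2
  have e3 : C * s ≤ C * δ := mul_le_mul_of_nonneg_left (by linarith) hC
  have e4 : C * (l - t) ≤ C * δ := mul_le_mul_of_nonneg_left (by linarith) hC
  have e5 := _root_.abs_sub_le (f' (γ 0)) (f' (γ s)) (f' (γ l))
  have e6 := _root_.abs_sub_le (f' (γ s)) (f' (γ t)) (f' (γ l))
  nlinarith [hl.2]

/-- Rational lengths suffice, so nontrivial sublevel sets are countable unions of analytic sets. -/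
theorem aemeasurable_truncatedDist {d : MetricSpace X} {g : X → ℝ≥0∞} {E : Set X} {M : ℝ}
    (hX : IsMetricMeasureSpace d μ) (hg : Measurable g)
    (hE : MeasurableSet E) (hM : 0 ≤ M) : AEMeasurable (truncatedDist d g E M) μ := by
  have := hX.borel
  have := hX.proper
  have : IsFiniteMeasureOnCompacts μ := ⟨fun K hK => by
    rcases K.eq_empty_or_nonempty with rfl | ⟨x, hx⟩
    · simp
    obtain ⟨r, hr⟩ := hK.isBounded.subset_ball x
    exact (measure_mono hr).trans_lt (hX.ball_lt_top x r)⟩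
  refine NullMeasurable.aemeasurable (measurable_of_Iio (α := ℝ)
    (δ := NullMeasurableSpace X μ) fun a => ?_)
  change NullMeasurableSet {y | truncatedDist d g E M y < a} μ
  have : {y | truncatedDist d g E M y < a} =
      {y | M < a} ∪ ⋃ q : {q : ℚ // (q : ℝ) < a}, {y | ∃ x ∈ E, Joins d g (q : ℚ) x y} := by
    ext y
    simp only [mem_ofPred_eq, truncatedDist_lt_iff hM, mem_union, mem_iUnion]
    refine or_congr_right ⟨?_, ?_⟩
    · rintro ⟨L, hL, x, hx, h⟩
      obtain ⟨q, hLq, hqa⟩ := exists_rat_btwn hL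
      exact ⟨⟨q, hqa⟩, x, hx, h.mono hLq.le⟩
    · rintro ⟨q, h⟩
      exact ⟨_, q.2, h⟩
  rw [this]
  exact (MeasurableSet.const _).nullMeasurableSet.union (NullMeasurableSet.iUnion fun q =>
    (Joins.analyticSet hg hE _).nullMeasurableSet)

end

/-! ### The metric `dp`, its thick geodesicity and its minimality. -/

section
variable {X : Type*} [MeasurableSpace X] {μ : Measure X} {p : ℝ≥0∞}

/-- Continuous functions for which `1` is a `p`-weak upper gradient. -/
def ContinuousUnitUpperGradient (d : MetricSpace X) (μ : Measure X) (p : ℝ≥0∞) (f : X → ℝ) :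
    Prop :=
  Continuous f ∧ HasUnitUpperGradient d μ p f

theorem continuousUnitUpperGradient_dist (hp : p ≠ 0) (d : MetricSpace X) (z : X) :
    ContinuousUnitUpperGradient d μ p (d.dist z) :=
  ⟨continuous_const.dist continuous_id, _, IsModulusWeight.zero hp, fun x y _ h => by
    rw [dist_comm z, dist_comm z]
    exact (abs_dist_sub_le x y z).trans h.dist_le⟩

/-- The largest metric for which every continuous function with `p`-weak upper gradient `1` is
`1`-Lipschitz. -/
theorem exists_metric_of_unitUpperGradient (hp : p ≠ 0) {d : MetricSpace X}
    (hX : IsMetricMeasureSpace d μ) {C : ℝ} (hC : 0 ≤ C) (hthick : ThickQuasiconvex d μ p C) :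
    ∃ dp : MetricSpace X, (∀ x y, d.dist x y ≤ dp.dist x y) ∧
      (∀ x y, dp.dist x y ≤ C * d.dist x y) ∧
      (∀ f : X → ℝ, ContinuousUnitUpperGradient d μ p f → ∀ x y, |f x - f y| ≤ dp.dist x y) ∧
      ∀ x y M, (∀ f : X → ℝ, ContinuousUnitUpperGradient d μ p f → |f x - f y| ≤ M) →
        dp.dist x y ≤ M := by
  let F := {f : X → ℝ // ContinuousUnitUpperGradient d μ p f}
  let D : X → X → ℝ := fun x y => ⨆ f : F, |f.1 x - f.1 y|
  have hle : ∀ (f : F) x y, |f.1 x - f.1 y| ≤ C * d.dist x y := fun f x y =>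
    f.2.2.abs_sub_le hp hX hC hthick f.2.1 x y
  have hbdd : ∀ x y, BddAbove (range fun f : F => |f.1 x - f.1 y|) := fun x y =>
    ⟨C * d.dist x y, forall_mem_range.2 fun f => hle f x y⟩
  have hDle : ∀ (f : F) x y, |f.1 x - f.1 y| ≤ D x y := fun f x y => le_ciSup (hbdd x y) f
  have hF : X → Nonempty F := fun z => ⟨⟨d.dist z, continuousUnitUpperGradient_dist hp d z⟩⟩
  have hDsup : ∀ x y M, (∀ f : F, |f.1 x - f.1 y| ≤ M) → D x y ≤ M := fun x y M h =>
    have := hF x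
    ciSup_le h
  have hdD : ∀ x y, d.dist x y ≤ D x y := fun x y => by
    have := hDle ⟨d.dist x, continuousUnitUpperGradient_dist hp d x⟩ x y
    simpa using this
  refine ⟨{
    dist := D
    dist_self := fun x => by simp [D]
    dist_comm := fun x y => by simp only [D, abs_sub_comm]
    dist_triangle := fun x y z => hDsup _ _ _ fun f =>
      (abs_sub_le _ (f.1 y) _).trans (add_le_add (hDle f x y) (hDle f y z))
    eq_of_dist_eq_zero := fun {x y} h =>
      @dist_le_zero X d x y |>.1 ((hdD x y).trans h.le) },
    hdD, fun x y => hDsup _ _ _ fun f => hle f x y, fun f hf x y => hDle ⟨f, hf⟩ x y,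
    fun x y M h => hDsup _ _ _ fun f => h f.1 f.2⟩

/-- One weight serves for all continuous functions with `p`-weak upper gradient `1`. -/
theorem exists_isModulusWeight_forall_unitUpperGradient (hp : p ≠ 0) {d : MetricSpace X}
    (hX : IsMetricMeasureSpace d μ) :
    ∃ g, IsModulusWeight p μ g ∧ ∀ f : X → ℝ, ContinuousUnitUpperGradient d μ p f →
      ∀ x y L, Joins d g L x y → |f x - f y| ≤ L := by
  have := hX.proper
  -- A weight dominating those of a dense sequence in `F` works for all of `F`, since for fixed `x`,
  -- `y` the inequality is closed under pointwise limits.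
  let F : Set C(X, ℝ) := {f | HasUnitUpperGradient d μ p f}
  have : SecondCountableTopology C(X, ℝ) := inferInstance
  have : Nonempty F := ⟨⟨0, _, IsModulusWeight.zero hp, fun x y L h => by
    simpa using dist_nonneg.trans h.dist_le⟩⟩
  choose g hg hfg using fun n => (TopologicalSpace.denseSeq F n).2
  obtain ⟨G, hG, hdom⟩ := IsModulusWeight.exists_dominating hp hg
  refine ⟨G, hG, fun f ⟨hf, hf'⟩ x y L h => ?_⟩
  have hclosed : IsClosed {f : F | |f.1 x - f.1 y| ≤ L} := by
    refine isClosed_le ?_ continuous_const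
    have hev : ∀ z, Continuous fun f : F => f.1 z := fun z =>
      (continuous_eval_const z).comp continuous_subtype_val
    exact ((hev x).sub (hev y)).abs
  refine (TopologicalSpace.denseRange_denseSeq F).induction_on
    (p := fun f => |f.1 x - f.1 y| ≤ L) ⟨⟨f, hf⟩, hf'⟩ hclosed fun n => ?_
  obtain ⟨c, hc, hcg⟩ := hdom n
  exact hfg n x y L (h.of_const_mul_le hc hcg)

theorem exists_mem_forall_inter_ball_pos (d : MetricSpace X) [ProperSpace X] {E : Set X}
    (hE : 0 < μ E) : ∃ x ∈ E, ∀ δ > 0, 0 < μ (E ∩ Metric.ball x δ) := by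
  obtain ⟨x, hx, h⟩ := exists_mem_forall_mem_nhdsWithin_pos_measure hE.ne'
  exact ⟨x, hx, fun δ hδ => h _ (inter_mem self_mem_nhdsWithin
    (mem_nhdsWithin_of_mem_nhds (Metric.ball_mem_nhds x hδ)))⟩

/-- If a metric comparable to `d` makes all continuous functions with `p`-weak upper gradient `1`
Lipschitz, and is bounded by the length of almost every curve, it is `p`-thick geodesic. -/
theorem thickGeodesic_of_unitUpperGradient (hp : p ≠ 0) {dp d : MetricSpace X}
    (hX : IsMetricMeasureSpace d μ) {C : ℝ} (hC : 0 ≤ C) (hthick : ThickQuasiconvex d μ p C)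
    (hle : ∀ x y, d.dist x y ≤ dp.dist x y) (hleC : ∀ x y, dp.dist x y ≤ C * d.dist x y)
    (hlip : ∀ f : X → ℝ, ContinuousUnitUpperGradient d μ p f →
      ∀ x y, |f x - f y| ≤ dp.dist x y)
    {g₀ : X → ℝ≥0∞} (hg₀ : IsModulusWeight p μ g₀)
    (hdp : ∀ x y L, Joins d g₀ L x y → dp.dist x y ≤ L) : ThickGeodesic dp μ p := by
  intro C' hC'
  have hC'0 : 0 ≤ C' := zero_le_one.trans hC'.le
  refine (thickQuasiconvex_iff hp dp hC'0).2 fun E F hE hF hE0 hF0 g hg => ?_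
  have := hX.proper
  have := hX.borel
  obtain ⟨x₀, hx₀, hxE⟩ := exists_mem_forall_inter_ball_pos d hE0
  obtain ⟨y₀, hy₀, hyF⟩ := exists_mem_forall_inter_ball_pos d hF0
  by_cases hxy : x₀ = y₀
  · exact ⟨x₀, hx₀, x₀, hxy ▸ hy₀, Joins.refl
      (mul_nonneg hC'0 (@dist_nonneg X dp.toPseudoMetricSpace _ _)) x₀⟩
  have hr : 0 < d.dist x₀ y₀ := dist_pos.2 hxy
  set r := d.dist x₀ y₀ with hrdef
  -- `δ` solves `(2 * C + 1) * δ = (C' - 1) * (r - 2 * δ)`: the left side is the excess of the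
  -- curve's length bound over `dp x' y`, the right side the slack provided by `C'`.
  have hden : 0 < 2 * C + 1 + 2 * (C' - 1) := by linarith
  obtain ⟨δ, hδ, hδr⟩ : ∃ δ > 0, δ * (2 * C + 1 + 2 * (C' - 1)) = (C' - 1) * r :=
    ⟨_, div_pos (mul_pos (sub_pos.2 hC') hr) hden, div_mul_cancel₀ _ hden.ne'⟩
  have hball := (Metric.isOpen_ball (x := x₀) (ε := δ)).measurableSet
  obtain ⟨E', hE'E, hE', hEE'⟩ :=
    (hE.inter hball.nullMeasurableSet).exists_measurable_subset_ae_eq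
  obtain ⟨G, hG, ⟨c, hc, hcg⟩, ⟨c₀, hc₀, hcg₀⟩⟩ := hg.exists_dominating₂ hp hg₀
  -- This height is at least `dp x y + δ` for the points chosen below, so the truncation is inactive
  -- there.
  have hM : 0 ≤ C * (r + 2 * δ) + δ := by positivity
  obtain ⟨f, hf, hfgrad, hfae⟩ := HasUnitUpperGradient.exists_continuous_ae_eq hp hX hC hthick
    (f := truncatedDist d G E' (C * (r + 2 * δ) + δ))
    ⟨G, hG, fun x y L h => abs_truncatedDist_sub_le hM h⟩
    (aemeasurable_truncatedDist hX hG.1 hE' hM)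
  have hex : ∀ S : Set X, 0 < μ S →
      ∃ x ∈ S, f x = truncatedDist d G E' (C * (r + 2 * δ) + δ) x := fun S hS =>
    ((frequently_ae_mem_iff.2 hS.ne').and_eventually hfae).exists
  obtain ⟨x, hx, hfx⟩ := hex E' (by rw [measure_congr hEE']; exact hxE δ hδ)
  obtain ⟨y, ⟨hyF, hyball⟩, hfy⟩ := hex _ (hyF δ hδ)
  have hfx0 : f x ≤ 0 := by
    rw [hfx]
    exact csInf_le (bddBelow_truncatedDist hM x)
      (mem_insert_of_mem _ ⟨x, hx, Joins.refl le_rfl x⟩)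
  have hxball : ∀ z ∈ E', d.dist z x₀ < δ := fun z hz => (hE'E hz).2
  have hyball' : d.dist y y₀ < δ := hyball
  have hdxy : d.dist x y ≤ r + 2 * δ := by
    have h1 := dist_triangle4 x x₀ y₀ y
    have h2 := hxball x hx
    rw [dist_comm y₀ y] at h1
    linarith
  have hlt : truncatedDist d G E' (C * (r + 2 * δ) + δ) y < dp.dist x y + δ := by
    have := hlip f ⟨hf, hfgrad⟩ x y
    rw [abs_sub_comm] at this
    have := (le_abs_self _).trans this
    linarith
  rw [truncatedDist_lt_iff hM] at hlt
  obtain ⟨L, hL, x', hx', hj⟩ := hlt.resolve_left (by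
    have := (hleC x y).trans (mul_le_mul_of_nonneg_left hdxy hC)
    linarith)
  refine ⟨x', (hE'E hx').1, y, hyF, Joins.mono (L := L) ?_ ?_⟩
  · exact Joins.of_dist_le (fun a b l h => hdp a b l (h.of_const_mul_le hc₀ hcg₀)) hj
      |>.of_const_mul_le hc hcg
  · have h1 : dp.dist x y ≤ dp.dist x x' + dp.dist x' y := dp.dist_triangle x x' y
    have h2 : d.dist x x' ≤ 2 * δ := by
      have := dist_triangle_right x x' x₀
      linarith [hxball x hx, hxball x' hx']
    have h3 := (hleC x x').trans (mul_le_mul_of_nonneg_left h2 hC)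
    have h4 : r - 2 * δ ≤ d.dist x' y := by
      have := dist_triangle4 x₀ x' y y₀
      rw [dist_comm x₀ x'] at this
      linarith [hxball x' hx']
    have h5 := mul_le_mul_of_nonneg_left (h4.trans (hle x' y)) (sub_pos.2 hC').le
    linarith

/-- Curves that are `1`-Lipschitz for `ρ` are so for `d ≤ ρ`, so `f` keeps its upper gradient `1`
for `ρ` and is `C`-Lipschitz for every `C > 1`. -/
theorem ContinuousUnitUpperGradient.abs_sub_le_of_thickGeodesic (hp : p ≠ 0)
    {ρ d : MetricSpace X} (hρ : IsMetricMeasureSpace ρ μ) (hle : ∀ x y, d.dist x y ≤ ρ.dist x y)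
    (hgeo : ThickGeodesic ρ μ p) {f : X → ℝ} (hf : ContinuousUnitUpperGradient d μ p f) (x y : X) :
    |f x - f y| ≤ ρ.dist x y := by
  obtain ⟨hcont, hf⟩ := hf
  have hcont' : Continuous[ρ.toUniformSpace.toTopologicalSpace, _] f :=
    continuous_le_dom (continuous_id_of_dist_le_mul zero_le_one
      fun x y => (one_mul (ρ.dist x y)).symm ▸ hle x y) hcont
  obtain ⟨g, hg, hfg⟩ := hf
  have hf' : HasUnitUpperGradient ρ μ p f :=
    ⟨g, hg, fun x y L h => hfg x y L (h.of_metric_le hle)⟩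
  have key : ∀ C > (1 : ℝ), |f x - f y| ≤ C * ρ.dist x y := fun C hC =>
    hf'.abs_sub_le hp hρ (zero_le_one.trans hC.le) (hgeo C hC) hcont' x y
  have hlim : Tendsto (fun C : ℝ => C * ρ.dist x y) (𝓝[>] 1) (𝓝 (1 * ρ.dist x y)) :=
    ((continuous_id.mul continuous_const).tendsto 1).mono_left nhdsWithin_le_nhds
  rw [one_mul] at hlim
  exact ge_of_tendsto hlim (eventually_mem_nhdsWithin.mono key)

end

theorem theorem1p4 {X : Type*} [MeasurableSpace X] (d : MetricSpace X) (μ : Measure X)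
    (hX : IsMetricMeasureSpace d μ) (hdoub : InfinitesimallyDoubling d μ)
    (p : ℝ≥0∞) (hp : 1 ≤ p) (C : ℝ) (hC : 1 ≤ C) (hthick : ThickQuasiconvex d μ p C) :
    ∃ dp : MetricSpace X,
      (∀ x y : X, d.dist x y ≤ dp.dist x y ∧ dp.dist x y ≤ C * d.dist x y) ∧
      IsMetricMeasureSpace dp μ ∧
      ThickGeodesic dp μ p ∧
      ∀ ρ : MetricSpace X, IsMetricMeasureSpace ρ μ → (∀ x y : X, d.dist x y ≤ ρ.dist x y) →
        ThickGeodesic ρ μ p → ∀ x y : X, dp.dist x y ≤ ρ.dist x y := by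
  have hp0 : p ≠ 0 := (zero_lt_one.trans_le hp).ne'
  have hCpos : 0 < C := zero_lt_one.trans_le hC
  obtain ⟨dp, hle, hleC, hlip, hsup⟩ :=
    exists_metric_of_unitUpperGradient hp0 hX hCpos.le hthick
  obtain ⟨g, hg, hfg⟩ := exists_isModulusWeight_forall_unitUpperGradient hp0 hX
  exact ⟨dp, fun x y => ⟨hle x y, hleC x y⟩, hX.of_dist_le hCpos hle hleC,
    thickGeodesic_of_unitUpperGradient hp0 hX hCpos.le hthick hle hleC hlip hg
      fun x y L h => hsup x y L fun f hf => hfg f hf x y L h,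
    fun ρ hρ hdρ hgeo x y => hsup x y _ fun f hf =>
      hf.abs_sub_le_of_thickGeodesic hp0 hρ hdρ hgeo x y⟩
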